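/- Let $k$ be an algebraically closed field. A variety over $k$ is a reduced separated scheme of finite type over $k$ (not necessarily irreducible), and its points are its $k$-rational points. An algebraic semigroup over $k$ is a variety $S$ with an associative morphism $\mu : S\times S\to S$, written $(x,y)\mapsto xy$. A point $e$ of $S$ is idempotent if $e^2=e$; idempotents are ordered by $e\le f$ if and only if $e=ef=fe$. The scheme of idempotents $E(S)$ is the closed subscheme of $S$ obtained as the scheme-theoretic preimage of the diagonal under the morphism $S\to S\times S$, $x\mapsto (x^2,x)$. Let $S$ be a commutative algebraic semigroup over $k$. (i) The Zariski tangent space of $E(S)$ at each of its points is zero, and the scheme $E(S)$ is finite over $k$ and reduced. (ii) If $S$ is nonempty, then $S$ has a smallest idempotent $e_0$, i.e. an idempotent $e_0$ such that $e_0\le f$ for every idempotent $f$ of $S$. (iii) Let $F$ be a subfield of $k$ and suppose that $S$ is defined over $F$, that is, there are a separated $F$-scheme $S_0$ of finite type, an identification of $S$ with the base change $S_0\times_{\operatorname{Spec} F}\operatorname{Spec} k$, and a morphism of $F$-schemes $S_0\times_F S_0\to S_0$ whose base change to $k$ is $\mu$. Then the smallest idempotent $e_0$ is defined over $F$, that is,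 it is induced by an $F$-rational point of $S_0$. -/

import Mathlib

open CategoryTheory Limits AlgebraicGeometry MonoidalCategory CartesianMonoidalCategory

universe u

noncomputable section

/-- A `k`-scheme is a *variety* if it is reduced, separated and of finite type over `k`
(it need not be irreducible). -/
structure IsVariety {k : Type u} [Field k] (X : Over (Spec (.of k))) : Prop where
  isReduced : IsReduced X.left
  isSeparated : IsSeparated X.hom
  locallyOfFiniteType : LocallyOfFiniteType X.hom
  quasiCompact : QuasiCompact X.hom

/-- An *algebraic semigroup* over `k`: a variety with an associative composition law.
Products are fibre products over `k`. -/
structure AlgebraicSemigroup (k : Type u) [Field k] where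
  /-- the underlying variety -/
  carrier : Over (Spec (.of k))
  isVariety : IsVariety carrier
  /-- the composition law `S × S ⟶ S` -/
  mul : carrier ⊗ carrier ⟶ carrier
  mul_assoc : (mul ▷ carrier) ≫ mul =
    (α_ carrier carrier carrier).hom ≫ (carrier ◁ mul) ≫ mul

namespace AlgebraicSemigroup

variable {k : Type u} [Field k] (S : AlgebraicSemigroup k)

/-- `S` is commutative: `xy = yx`, as morphisms `S × S ⟶ S`. -/
def IsCommutative : Prop :=
  lift (snd S.carrier S.carrier) (fst S.carrier S.carrier) ≫ S.mul = S.mul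

/-- The points of `S`, that is, its `k`-rational points. -/
abbrev Point : Type u := 𝟙_ (Over (Spec (.of k))) ⟶ S.carrier

variable {S} in
/-- The product of two points. -/
def Point.mul (x y : S.Point) : S.Point := lift x y ≫ S.mul

variable {S} in
/-- A point `e` is idempotent if `e ^ 2 = e`. -/
def Point.IsIdempotent (e : S.Point) : Prop := e.mul e = e

variable {S} in
/-- The order on idempotents: `e ≤ f` if `e = ef = fe`. -/
def Point.IdemLE (e f : S.Point) : Prop := e = e.mul f ∧ e = f.mul e

variable {S} in
/-- `e` is the smallest idempotent of `S`. -/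
def Point.IsSmallestIdempotent (e : S.Point) : Prop :=
  e.IsIdempotent ∧ ∀ f : S.Point, f.IsIdempotent → e.IdemLE f

/-- The morphism `S ⟶ S × S`, `x ↦ (x ^ 2, x)`. -/
def sqProd : S.carrier ⟶ S.carrier ⊗ S.carrier :=
  lift (lift (𝟙 S.carrier) (𝟙 S.carrier) ≫ S.mul) (𝟙 S.carrier)

/-- The diagonal morphism `S ⟶ S × S`. -/
def diag : S.carrier ⟶ S.carrier ⊗ S.carrier := lift (𝟙 S.carrier) (𝟙 S.carrier)

/-- The scheme of idempotents `E(S)`, a `k`-scheme: the scheme-theoretic preimage of the diagonal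
under `x ↦ (x ^ 2, x)`. -/
def idempotents : Over (Spec (.of k)) :=
  Over.mk (pullback.fst S.sqProd.left S.diag.left ≫ S.carrier.hom)

/-- An `F`-structure on the algebraic semigroup `S`: a separated `F`-scheme of finite type
`carrier` with an identification of `S` with its base change to `k` (given by a cartesian square
over `Spec k ⟶ Spec F`), and a morphism `mul` of `F`-schemes of which the composition law of `S`
is the base change. To have such a structure is to be defined over `F`. -/
structure FStructure (F : Type u) [Field F] [Algebra F k] where
  /-- the `F`-scheme from which `S` is obtained by base change -/
  carrier : Over (Spec (.of F))
  isSeparated : IsSeparated carrier.hom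
  locallyOfFiniteType : LocallyOfFiniteType carrier.hom
  quasiCompact : QuasiCompact carrier.hom
  /-- the projection from `S` -/
  proj : S.carrier.left ⟶ carrier.left
  isPullback : IsPullback proj S.carrier.hom carrier.hom
    (Spec.map (CommRingCat.ofHom (algebraMap F k)))
  /-- the composition law over `F` -/
  mul : carrier ⊗ carrier ⟶ carrier
  mul_comp_proj : S.mul.left ≫ proj =
    pullback.map S.carrier.hom S.carrier.hom carrier.hom carrier.hom proj proj
      (Spec.map (CommRingCat.ofHom (algebraMap F k))) isPullback.w.symm isPullback.w.symm ≫ mul.left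

variable {S} in
/-- A point `x` of `S` is defined over `F` (with respect to a given `F`-structure) if it is
induced by an `F`-rational point. -/
def Point.IsDefinedOver (x : S.Point) {F : Type u} [Field F] [Algebra F k]
    (S₀ : S.FStructure F) : Prop :=
  ∃ x₀ : 𝟙_ (Over (Spec (.of F))) ⟶ S₀.carrier,
    x.left ≫ S₀.proj = Spec.map (CommRingCat.ofHom (algebraMap F k)) ≫ x₀.left

end AlgebraicSemigroup

/-- The Zariski tangent space of a scheme at a point `x`: the dual of `𝔪 / 𝔪 ^ 2` over the residue
field, where `𝔪` is the maximal ideal of the local ring at `x`. -/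
abbrev ZariskiTangentSpace (X : Scheme.{u}) (x : X) : Type u :=
  Module.Dual (IsLocalRing.ResidueField (X.presheaf.stalk x))
    (IsLocalRing.CotangentSpace (X.presheaf.stalk x))

end

/-!
The `T`-valued points of a commutative algebraic semigroup `S` form a commutative semigroup,
functorially in the `k`-scheme `T`; every step below is a computation in such semigroups.

*The scheme of idempotents.* The differential of `x ↦ x²` at an idempotent `e` is `2L`, where `L` is
the differential of `x ↦ ex`, and `L² = L`. A tangent vector `u` of `E(S)` at `e` satisfies
`2Lu = u`; applying `L` gives `Lu = 0`, so `u = 0`, in every characteristic.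
`IsCommutative.specTrivSqZeroExtMap_zero_comp_eq` expresses this with points over the dual numbers
`k[ε]` and over `k[ε₁, ε₂] / (ε₁, ε₂)²`; points of the latter kind are determined by their two
restrictions because `S` is separated. As tangent vectors at all closed points vanish, the
differentials of `E(S)` vanish (`formallyUnramified_of_forall_dualNumber`), and a quasi-compact
scheme that is unramified over a field is finite and reduced, with fields as local rings.

*Existence of an idempotent.* Let `a` be a point. If `aⁿ = aᵐz` with `m ≥ 2n`, then `aⁿ` is a
multiple of its square, and some multiple of `aⁿ` is idempotent. The image of `(x, y) ↦ (x, xy)` is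
constructible by Chevalley's theorem and contains all `(aᵐ, aⁿ)` with `m < n`. As `S` is Noetherian,
the closure of the set of `aⁿ` with `n ≥ N` does not depend on `N` when `N` is large, so both these
pairs and those with `m ≥ 2n` are dense in the closure of the set of all pairs of large exponents.
A constructible set that contains a dense subset contains a nonempty open subset, and so meets every
dense subset (`IsCommutative.exists_isIdempotent`). The product of the finitely many idempotents is
the smallest one.

*Rationality.* Let `e` be the smallest idempotent. Since `E(S)` is reduced, `ef = e` for every
idempotent `T`-valued point `f`, for every `k`-scheme `T`. Over `Spec k ×[Spec F] Spec k` this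
applies to the two pullbacks of `e`, with either factor providing the structure of a `k`-scheme:
both pullbacks are equal to their product. Hence `e` descends along the faithfully flat morphism
`Spec k ⟶ Spec F` (`Point.IsSmallestIdempotent.isDefinedOver`).
-/

noncomputable section

/-! ### Semigroups of points -/

namespace AlgebraicSemigroup

variable {k : Type u} [Field k] (S : AlgebraicSemigroup k)

/-- The product of two `T`-valued points of `S`. -/
def homMul {T : Over (Spec (.of k))} (x y : T ⟶ S.carrier) : T ⟶ S.carrier :=
  lift x y ≫ S.mul

lemma comp_homMul {T T' : Over (Spec (.of k))} (f : T' ⟶ T) (x y : T ⟶ S.carrier) :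
    f ≫ S.homMul x y = S.homMul (f ≫ x) (f ≫ y) := by
  simp [homMul, ← Category.assoc]

lemma homMul_assoc {T : Over (Spec (.of k))} (x y z : T ⟶ S.carrier) :
    S.homMul (S.homMul x y) z = S.homMul x (S.homMul y z) := by
  have h := lift (lift x y) z ≫= S.mul_assoc
  simpa [homMul, ← Category.assoc] using h

variable {S} in
lemma IsCommutative.homMul_comm (hS : S.IsCommutative) {T : Over (Spec (.of k))}
    (x y : T ⟶ S.carrier) : S.homMul x y = S.homMul y x := by
  have h := lift y x ≫= hS
  simpa [homMul, ← Category.assoc] using h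

variable {S} in
/-- The `T`-valued points of a commutative algebraic semigroup form a commutative semigroup. -/
abbrev IsCommutative.homCommSemigroup (hS : S.IsCommutative) (T : Over (Spec (.of k))) :
    CommSemigroup (T ⟶ S.carrier) where
  mul := S.homMul
  mul_assoc := S.homMul_assoc
  mul_comm := hS.homMul_comm

/-- The inclusion of the scheme of idempotents in `S`. -/
def idempotentsι : S.idempotents ⟶ S.carrier :=
  Over.homMk (pullback.fst S.sqProd.left S.diag.left)

/-- The universal idempotent is sent to the diagonal by `x ↦ (x ^ 2, x)`. -/
lemma idempotentsι_comp_sqProd : ∃ y : S.idempotents ⟶ S.carrier,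
    S.idempotentsι ≫ S.sqProd = y ≫ S.diag := by
  have h : pullback.fst S.sqProd.left S.diag.left ≫ S.sqProd.left =
    pullback.snd S.sqProd.left S.diag.left ≫ S.diag.left := pullback.condition
  have h' := h =≫ (S.carrier ⊗ S.carrier).hom
  rw [Category.assoc, Category.assoc, Over.w, Over.w] at h'
  exact ⟨Over.homMk (pullback.snd S.sqProd.left S.diag.left) h'.symm, Over.OverMorphism.ext h⟩

lemma idempotentsι_homMul_self :
    S.homMul S.idempotentsι S.idempotentsι = S.idempotentsι := by
  obtain ⟨y, h⟩ := S.idempotentsι_comp_sqProd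
  have h1 := h =≫ fst _ _
  have h2 := h =≫ snd _ _
  simp only [sqProd, diag, Category.assoc, lift_fst, lift_snd, Category.comp_id] at h1 h2
  rw [← Category.assoc, comp_lift, Category.comp_id] at h1
  exact h1.trans h2.symm

/-- An idempotent `T`-valued point of `S` is a `T`-valued point of the scheme of idempotents. -/
lemma exists_comp_idempotentsι {T : Over (Spec (.of k))} (x : T ⟶ S.carrier)
    (hx : S.homMul x x = x) : ∃ y : T ⟶ S.idempotents, y ≫ S.idempotentsι = x := by
  have h : x ≫ S.sqProd = x ≫ S.diag := by
    rw [sqProd, diag, comp_lift, comp_lift, ← Category.assoc, comp_lift, Category.comp_id]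
    exact congr(lift $hx x)
  have h' : x.left ≫ S.sqProd.left = x.left ≫ S.diag.left := congr(($h).left)
  have h1 : pullback.lift x.left x.left h' ≫ pullback.fst S.sqProd.left S.diag.left = x.left :=
    pullback.lift_fst _ _ _
  refine ⟨Over.homMk (pullback.lift x.left x.left h') ?_, Over.OverMorphism.ext h1⟩
  exact (Category.assoc _ _ _).symm.trans ((h1 =≫ S.carrier.hom).trans (Over.w x))

instance : IsReduced S.carrier.left := S.isVariety.isReduced
instance : IsSeparated S.carrier.hom := S.isVariety.isSeparated
instance : LocallyOfFiniteType S.carrier.hom := S.isVariety.locallyOfFiniteType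
instance : QuasiCompact S.carrier.hom := S.isVariety.quasiCompact

instance : IsClosedImmersion S.diag.left := by
  have : IsClosedImmersion (S.diag.left ≫ (fst S.carrier S.carrier).left) := by
    rw [← Over.comp_left]; simp [diag]; infer_instance
  have : IsSeparated (fst S.carrier S.carrier).left := by
    change IsSeparated (pullback.fst _ _); infer_instance
  exact .of_comp _ (fst S.carrier S.carrier).left

instance : IsClosedImmersion S.idempotentsι.left :=
  inferInstanceAs (IsClosedImmersion (pullback.fst S.sqProd.left S.diag.left))

instance : Mono S.idempotentsι :=
  have : Mono S.idempotentsι.left := inferInstance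
  Over.mono_of_mono_left _

end AlgebraicSemigroup

/-! ### Rational points of schemes over an algebraically closed field -/

section Points

variable {k : Type u} [Field k]

/-- The closed point of a `k`-scheme underlying a `k`-rational point. -/
def underlyingPoint {X : Over (Spec (.of k))} (p : 𝟙_ (Over (Spec (.of k))) ⟶ X) : X.left :=
  p.left (IsLocalRing.closedPoint k)

lemma underlyingPoint_comp {X Y : Over (Spec (.of k))} (p : 𝟙_ (Over (Spec (.of k))) ⟶ X)
    (f : X ⟶ Y) : underlyingPoint (p ≫ f) = f.left (underlyingPoint p) := by
  rfl

variable [IsAlgClosed k]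

lemma underlyingPoint_injective {X : Over (Spec (.of k))} [LocallyOfFiniteType X.hom] :
    Function.Injective (underlyingPoint (X := X)) := by
  intro p q h
  exact Over.OverMorphism.ext
    (ext_of_apply_closedPoint_eq X.hom (Over.w p) (Over.w q) h)

lemma isClosed_underlyingPoint {X : Over (Spec (.of k))} [LocallyOfFiniteType X.hom]
    (p : 𝟙_ (Over (Spec (.of k))) ⟶ X) : IsClosed {underlyingPoint p} :=
  (pointEquivClosedPoint X.hom ⟨p.left, Over.w p⟩).2

lemma exists_underlyingPoint_eq {X : Over (Spec (.of k))} [LocallyOfFiniteType X.hom]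
    (x : X.left) (hx : IsClosed {x}) :
    ∃ p : 𝟙_ (Over (Spec (.of k))) ⟶ X, underlyingPoint p = x :=
  ⟨Over.homMk (pointOfClosedPoint X.hom x hx) (pointOfClosedPoint_comp X.hom x hx),
    pointOfClosedPoint_apply X.hom x hx _⟩

lemma exists_underlyingPoint_mem {X : Over (Spec (.of k))} [LocallyOfFiniteType X.hom]
    {Z : Set X.left} (hZ : IsClosed Z) (hZ' : Z.Nonempty) :
    ∃ p : 𝟙_ (Over (Spec (.of k))) ⟶ X, underlyingPoint p ∈ Z := by
  have : JacobsonSpace X.left := LocallyOfFiniteType.jacobsonSpace X.hom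
  obtain ⟨x, hx, hx'⟩ := nonempty_inter_closedPoints hZ' hZ.isLocallyClosed
  obtain ⟨p, rfl⟩ := exists_underlyingPoint_eq x hx'
  exact ⟨p, hx⟩

/-- Morphisms from a reduced scheme to a separated one are determined by their effect on
`k`-rational points. -/
lemma hom_ext_of_forall_point {X Y : Over (Spec (.of k))} [IsReduced X.left]
    [LocallyOfFiniteType X.hom] [IsSeparated Y.hom] [LocallyOfFiniteType Y.hom] {f g : X ⟶ Y}
    (h : ∀ p : 𝟙_ (Over (Spec (.of k))) ⟶ X, p ≫ f = p ≫ g) : f = g := by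
  have : LocallyOfFiniteType (f.left ≫ Y.hom) := by rw [Over.w]; infer_instance
  refine Over.OverMorphism.ext (ext_of_apply_eq Y.hom Set.univ isClosed_univ.isLocallyClosed
    dense_univ (fun x _ hx ↦ ?_) ((Over.w f).trans (Over.w g).symm))
  obtain ⟨p, rfl⟩ := exists_underlyingPoint_eq x hx
  rw [← underlyingPoint_comp, ← underlyingPoint_comp, h]

end Points

/-! ### Rationality of the smallest idempotent -/

namespace AlgebraicSemigroup

variable {k : Type u} [Field k] {S : AlgebraicSemigroup k}

instance : LocallyOfFiniteType S.idempotents.hom :=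
  inferInstanceAs (LocallyOfFiniteType (S.idempotentsι.left ≫ S.carrier.hom))

instance : QuasiCompact S.idempotents.hom :=
  inferInstanceAs (QuasiCompact (S.idempotentsι.left ≫ S.carrier.hom))

/-- The product of the smallest idempotent with any idempotent `T`-valued point is the smallest
idempotent. For `k`-rational points this is the definition; it passes to the universal idempotent
because the scheme of idempotents is reduced. -/
lemma Point.IsSmallestIdempotent.homMul_eq [IsAlgClosed k] [IsReduced S.idempotents.left]
    {e : S.Point} (he : e.IsSmallestIdempotent) {T : Over (Spec (.of k))} (x : T ⟶ S.carrier)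
    (hx : S.homMul x x = x) : S.homMul (toUnit T ≫ e) x = toUnit T ≫ e := by
  have key : S.homMul (toUnit S.idempotents ≫ e) S.idempotentsι = toUnit S.idempotents ≫ e := by
    refine hom_ext_of_forall_point fun p ↦ ?_
    have hp : S.homMul (p ≫ S.idempotentsι) (p ≫ S.idempotentsι) = p ≫ S.idempotentsι := by
      rw [← comp_homMul, idempotentsι_homMul_self]
    rw [comp_homMul, ← Category.assoc, toUnit_unique (p ≫ toUnit _) (𝟙 _), Category.id_comp]
    exact (he.2 _ hp).1.symm
  obtain ⟨y, rfl⟩ := S.exists_comp_idempotentsι x hx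
  have := y ≫= key
  rwa [comp_homMul, ← Category.assoc, toUnit_unique (y ≫ toUnit _) (toUnit _)] at this

namespace FStructure

variable {F : Type u} [Field F] [Algebra F k] (S₀ : S.FStructure F)

/-- The morphism `Spec k ⟶ Spec F`. -/
abbrev specMap (F k : Type u) [Field F] [Field k] [Algebra F k] : Spec (.of k) ⟶ Spec (.of F) :=
  Spec.map (CommRingCat.ofHom (algebraMap F k))

/-- Projecting the product of two points of `S` to the `F`-structure gives the product of the
projections. -/
lemma homMul_left_comp_proj {T : Over (Spec (.of k))} (x y : T ⟶ S.carrier)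
    (x₀ y₀ : Over.mk (T.hom ≫ specMap F k) ⟶ S₀.carrier)
    (hx : x.left ≫ S₀.proj = x₀.left) (hy : y.left ≫ S₀.proj = y₀.left) :
    (S.homMul x y).left ≫ S₀.proj = (lift x₀ y₀ ≫ S₀.mul).left := by
  have h : (lift x y).left ≫ pullback.map S.carrier.hom S.carrier.hom S₀.carrier.hom
      S₀.carrier.hom S₀.proj S₀.proj (specMap F k) S₀.isPullback.w.symm S₀.isPullback.w.symm =
      (lift x₀ y₀).left := by
    apply pullback.hom_ext
    · rw [Category.assoc, pullback.lift_fst, Over.lift_left, Over.lift_left, pullback.lift_fst,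
        ← Category.assoc, pullback.lift_fst, hx]
    · rw [Category.assoc, pullback.lift_snd, Over.lift_left, Over.lift_left, pullback.lift_snd,
        ← Category.assoc, pullback.lift_snd, hy]
  rw [homMul, Over.comp_left, Category.assoc, S₀.mul_comp_proj, Over.comp_left, ← h,
    Category.assoc]

/-- Every `F`-morphism from a `k`-scheme to the `F`-structure comes from a point of `S`. -/
lemma exists_left_comp_proj {T : Over (Spec (.of k))}
    (x₀ : Over.mk (T.hom ≫ specMap F k) ⟶ S₀.carrier) :
    ∃ x : T ⟶ S.carrier, x.left ≫ S₀.proj = x₀.left :=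
  ⟨Over.homMk (S₀.isPullback.lift x₀.left T.hom (Over.w x₀)) (S₀.isPullback.lift_snd _ _ _),
    S₀.isPullback.lift_fst _ _ _⟩

lemma hom_ext {T : Over (Spec (.of k))} {x y : T ⟶ S.carrier}
    (h : x.left ≫ S₀.proj = y.left ≫ S₀.proj) : x = y :=
  Over.OverMorphism.ext (S₀.isPullback.hom_ext h ((Over.w x).trans (Over.w y).symm))

variable (e : S.Point)

/-- The `F`-morphism `Spec k ⟶ S₀` underlying a point of `S`. -/
def pointProj : Over.mk ((𝟙_ (Over (Spec (.of k)))).hom ≫ specMap F k) ⟶ S₀.carrier :=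
  Over.homMk (e.left ≫ S₀.proj) (by
    dsimp only [Over.mk_hom]
    rw [Category.assoc, S₀.isPullback.w, ← Category.assoc, Over.w])

variable {e} in
lemma pointProj_idempotent (he : e.IsIdempotent) :
    lift (S₀.pointProj e) (S₀.pointProj e) ≫ S₀.mul = S₀.pointProj e := by
  apply Over.OverMorphism.ext
  rw [← S₀.homMul_left_comp_proj e e _ _ rfl rfl]
  exact congr(($he).left ≫ S₀.proj)

/-- If `e` is the smallest idempotent and `q₁, q₂ : T ⟶ Spec k` are morphisms over `Spec F`, then
the two pullbacks of `e` to `T` have the first one as their product: this is a product of points of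
`S` over the `k`-scheme `T` with structure morphism `q₁`. -/
lemma mul_eq_of_left_eq [IsAlgClosed k] [IsReduced S.idempotents.left] (hS : S.IsCommutative)
    {e : S.Point} (he : e.IsSmallestIdempotent) {T : Scheme.{u}} {q₁ q₂ : T ⟶ Spec (.of k)}
    {t : T ⟶ Spec (.of F)} (h₁ : q₁ ≫ specMap F k = t) (h₂ : q₂ ≫ specMap F k = t)
    (x y : Over.mk t ⟶ S₀.carrier)
    (hx : x.left = q₁ ≫ e.left ≫ S₀.proj) (hy : y.left = q₂ ≫ e.left ≫ S₀.proj) :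
    lift x y ≫ S₀.mul = x ∧ lift y x ≫ S₀.mul = x := by
  subst h₁
  let T₁ : Over (Spec (.of k)) := Over.mk q₁
  have hx' : (toUnit T₁ ≫ e).left ≫ S₀.proj = x.left := by
    rw [hx, Over.comp_left, Category.assoc]
    exact congr($(Over.w (toUnit T₁)) ≫ e.left ≫ S₀.proj)
  obtain ⟨y₁, hy'⟩ := S₀.exists_left_comp_proj (T := T₁) y
  have hyy : S.homMul y₁ y₁ = y₁ := by
    apply S₀.hom_ext
    rw [S₀.homMul_left_comp_proj y₁ y₁ y y hy' hy', hy']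
    let q : Over.mk (q₁ ≫ specMap F k) ⟶
        Over.mk ((𝟙_ (Over (Spec (.of k)))).hom ≫ specMap F k) :=
      Over.homMk q₂ (by rw [← h₂]; exact congr(q₂ ≫ $(Category.id_comp _)))
    have hq : y = q ≫ S₀.pointProj e := Over.OverMorphism.ext hy
    rw [hq, ← comp_lift, Category.assoc, S₀.pointProj_idempotent he.1]
  have h := he.homMul_eq y₁ hyy
  have h' := h
  rw [hS.homMul_comm] at h'
  constructor
  · apply Over.OverMorphism.ext
    rw [← S₀.homMul_left_comp_proj (T := T₁) _ _ x y hx' hy', h, hx']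
  · apply Over.OverMorphism.ext
    rw [← S₀.homMul_left_comp_proj (T := T₁) _ _ y x hy' hx', h', hx']

end FStructure

variable {F : Type u} [Field F] [Algebra F k]

open FStructure in
/-- Descent of the smallest idempotent: its two pullbacks to `Spec k ×[Spec F] Spec k` agree, as
each of them equals their product, so it descends along the faithfully flat `Spec k ⟶ Spec F`. -/
lemma Point.IsSmallestIdempotent.isDefinedOver [IsAlgClosed k] [IsReduced S.idempotents.left]
    (hS : S.IsCommutative) {e : S.Point} (he : e.IsSmallestIdempotent) (S₀ : S.FStructure F) :
    e.IsDefinedOver S₀ := by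
  let q₁ := pullback.fst (specMap F k) (specMap F k)
  let q₂ := pullback.snd (specMap F k) (specMap F k)
  have hq : q₁ ≫ specMap F k = q₂ ≫ specMap F k := pullback.condition
  have hproj : (e.left ≫ S₀.proj) ≫ S₀.carrier.hom = specMap F k := by
    rw [Category.assoc, S₀.isPullback.w, ← Category.assoc, Over.w]
    exact Category.id_comp _
  let x : Over.mk (q₁ ≫ specMap F k) ⟶ S₀.carrier := Over.homMk (q₁ ≫ e.left ≫ S₀.proj) (by
    rw [Category.assoc, hproj]; rfl)
  let y : Over.mk (q₁ ≫ specMap F k) ⟶ S₀.carrier := Over.homMk (q₂ ≫ e.left ≫ S₀.proj) (by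
    rw [Category.assoc, hproj]; exact hq.symm)
  have hxy : x = y :=
    (S₀.mul_eq_of_left_eq hS he rfl hq.symm x y rfl rfl).1.symm.trans
      (S₀.mul_eq_of_left_eq hS he hq.symm rfl y x rfl rfl).2
  obtain ⟨_, _⟩ := (flat_and_surjective_SpecMap_iff
    (CommRingCat.ofHom (algebraMap F k))).2
      ((RingHom.faithfullyFlat_algebraMap_iff (R := F) (S := k)).2 inferInstance)
  have : IsRegularEpi (specMap F k) := isRegularEpi_of_flat_of_surjective_of_isAffine _
  obtain ⟨u, hu⟩ := IsRegularEpi.exists_of_isKernelPair (specMap F k)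
    (IsPullback.of_hasPullback _ _) (e.left ≫ S₀.proj) congr(($hxy).left)
  refine ⟨Over.homMk u ?_, hu.symm⟩
  rw [← cancel_epi (specMap F k), ← Category.assoc, hu, hproj]
  exact (Category.comp_id _).symm

end AlgebraicSemigroup

/-! ### Constructible sets and sequences -/

section Topology

variable {X : Type*} [TopologicalSpace X]

/-- A constructible set is, generically on any nonempty set `A`, either everything or nothing. -/
lemma Topology.IsConstructible.exists_isOpen_inter_closure_subset_or {I : Set X}
    (hI : Topology.IsConstructible I) :
    ∀ A : Set X, A.Nonempty → ∃ W : Set X, IsOpen W ∧ (W ∩ A).Nonempty ∧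
      (W ∩ closure A ⊆ I ∨ W ∩ closure A ⊆ Iᶜ) := by
  induction hI using Topology.IsConstructible.empty_union_induction with
  | open_retrocompact U hU _ =>
    intro A hA
    by_cases h : (U ∩ A).Nonempty
    · exact ⟨U, hU, h, .inl Set.inter_subset_left⟩
    · refine ⟨Set.univ, isOpen_univ, by simpa using hA, .inr ?_⟩
      rw [Set.univ_inter]
      exact closure_minimal (fun x hx hxU ↦ h ⟨x, hxU, hx⟩) hU.isClosed_compl
  | union s _ t _ hs ht =>
    intro A hA
    obtain ⟨W, hW, hWA, h | h⟩ := hs A hA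
    · exact ⟨W, hW, hWA, .inl (h.trans Set.subset_union_left)⟩
    obtain ⟨V, hV, ⟨x, hxV, hx⟩, h'⟩ := ht (W ∩ A) hWA
    have hsub : V ∩ W ∩ closure A ⊆ V ∩ closure (W ∩ A) := fun y hy ↦
      ⟨hy.1.1, hW.inter_closure ⟨hy.1.2, hy.2⟩⟩
    refine ⟨V ∩ W, hV.inter hW, ⟨x, ⟨hxV, hx.1⟩, hx.2⟩, h'.imp (fun h' ↦ ?_) (fun h' ↦ ?_)⟩
    · exact (hsub.trans h').trans Set.subset_union_right
    · intro y hy hy'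
      exact hy'.elim (h ⟨hy.1.2, hy.2⟩) (h' (hsub hy))
  | compl s _ hs =>
    intro A hA
    obtain ⟨W, hW, hWA, h⟩ := hs A hA
    exact ⟨W, hW, hWA, by rw [compl_compl]; exact h.symm⟩

/-- A constructible set containing a dense subset of a nonempty closed set meets every dense subset
of that closed set. -/
lemma Topology.IsConstructible.inter_nonempty {I A B : Set X}
    (hI : Topology.IsConstructible I) (hA : A.Nonempty) (hAI : A ⊆ I) (hAB : A ⊆ closure B)
    (hBA : B ⊆ closure A) : (I ∩ B).Nonempty := by
  obtain ⟨W, hW, ⟨x, hxW, hxA⟩, h⟩ := hI.exists_isOpen_inter_closure_subset_or A hA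
  obtain ⟨y, hyW, hyB⟩ := mem_closure_iff.1 (hAB hxA) W hW hxW
  refine ⟨y, h.resolve_right (fun h ↦ ?_) ⟨hyW, hBA hyB⟩, hyB⟩
  exact h ⟨hxW, subset_closure hxA⟩ (hAI hxA)

/-- In a Noetherian space, the closures of the tails of a sequence stabilize. -/
lemma exists_forall_mem_closure_image_Ici [TopologicalSpace.NoetherianSpace X] (u : ℕ → X) :
    ∃ N, ∀ n m, N ≤ m → u m ∈ closure (u '' Set.Ici n) := by
  let T (n : ℕ) : TopologicalSpace.Closeds X := ⟨closure (u '' Set.Ici n), isClosed_closure⟩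
  have hwf : WellFounded ((· < ·) : TopologicalSpace.Closeds X → _ → Prop) :=
    (((TopologicalSpace.noetherianSpace_TFAE X).out 0 1 :
      TopologicalSpace.NoetherianSpace X ↔ WellFoundedLT (TopologicalSpace.Closeds X)).1
        inferInstance).wf
  obtain ⟨_, ⟨N, rfl⟩, hN⟩ := hwf.has_min (Set.range T) (Set.range_nonempty _)
  -- A minimal `T N` equals all later ones, in particular the one at `max N n`.
  refine ⟨N, fun n m hm ↦ ?_⟩
  have hle : T (max N n) ≤ T N :=
    closure_mono (Set.image_mono (Set.Ici_subset_Ici.2 (le_max_left _ _)))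
  have heq : T (max N n) = T N := hle.eq_of_not_lt (hN _ ⟨_, rfl⟩)
  have hmem : u m ∈ T (max N n) := by
    rw [heq]
    exact subset_closure ⟨m, hm, rfl⟩
  exact closure_mono (Set.image_mono (Set.Ici_subset_Ici.2 (le_max_right _ _))) hmem

end Topology

/-! ### Idempotents in commutative semigroups -/

section CommSemigroup

variable {M : Type*} [CommSemigroup M]

/-- The sequence of powers `a, a², a³, …` in a semigroup; `p n` is the `(n + 1)`-st power. -/
lemma exists_seq_mul_eq_add_succ (a : M) :
    ∃ p : ℕ → M, ∀ m n, p m * p n = p (m + n + 1) := by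
  refine ⟨fun n ↦ Nat.rec a (fun _ x ↦ a * x) n, fun m n ↦ ?_⟩
  induction m with
  | zero => rw [Nat.zero_add]; rfl
  | succ m ih => rw [Nat.add_right_comm m 1 n]; change a * _ * _ = a * _; rw [mul_assoc, ih]

/-- If a power of `a` is a multiple of its square, then some multiple of it is idempotent. As `p i`
is the `(i + 1)`-st power, `2 * n + 1 ≤ m` says that the exponent of `p m` is at least twice that of
`p n`. -/
lemma exists_idempotent_of_seq {p : ℕ → M} (hp : ∀ m n, p m * p n = p (m + n + 1)) {m n : ℕ}
    (hmn : 2 * n + 1 ≤ m) {z : M} (hz : p n = p m * z) : ∃ e : M, e * e = e := by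
  obtain ⟨w, hw⟩ : ∃ w, p n = p n * p n * w := by
    rw [hp, ← two_mul]
    obtain rfl | hlt := hmn.eq_or_lt
    · exact ⟨z, hz⟩
    · obtain ⟨r, rfl⟩ := Nat.exists_eq_add_of_lt hlt
      exact ⟨p r * z, by rw [← mul_assoc, hp, hz]⟩
  refine ⟨p n * w, ?_⟩
  rw [mul_mul_mul_comm, ← mul_assoc, ← hw]

/-- If a commutative semigroup has finitely many idempotents, and at least one, then their product
is the smallest one. -/
lemma exists_idempotent_mul_eq_of_finite (hfin : {e : M | e * e = e}.Finite)
    (hne : {e : M | e * e = e}.Nonempty) : ∃ e : M, e * e = e ∧ ∀ f : M, f * f = f → e * f = e := by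
  suffices h : ∀ s : Set M, s.Finite → s ⊆ {e : M | e * e = e} →
      ∃ e : M, e * e = e ∧ ∀ f ∈ s, e * f = e by
    obtain ⟨e, he, h⟩ := h _ hfin subset_rfl
    exact ⟨e, he, fun f hf ↦ h f hf⟩
  intro s hs
  induction s, hs using Set.Finite.induction_on with
  | empty => exact fun _ ↦ ⟨hne.some, hne.some_mem, by simp⟩
  | @insert a s _ _ ih =>
    intro hsub
    obtain ⟨e, he, h⟩ := ih ((Set.subset_insert _ _).trans hsub)
    have ha : a * a = a := hsub (Set.mem_insert _ _)
    refine ⟨e * a, by rw [mul_mul_mul_comm, he, ha], fun f hf ↦ ?_⟩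
    obtain rfl | hf := hf
    · rw [mul_assoc, ha]
    · rw [mul_right_comm, h f hf]

end CommSemigroup

/-! ### Existence of a smallest idempotent -/

namespace AlgebraicSemigroup

variable {k : Type u} [Field k] {S : AlgebraicSemigroup k}

instance : LocallyOfFiniteType (S.carrier ⊗ S.carrier).hom := by
  change LocallyOfFiniteType (pullback.fst S.carrier.hom S.carrier.hom ≫ S.carrier.hom)
  infer_instance

instance : QuasiCompact (S.carrier ⊗ S.carrier).hom := by
  change QuasiCompact (pullback.fst S.carrier.hom S.carrier.hom ≫ S.carrier.hom)
  infer_instance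

lemma isNoetherian_left (X : Over (Spec (.of k))) [LocallyOfFiniteType X.hom]
    [QuasiCompact X.hom] : IsNoetherian X.left := by
  have : IsLocallyNoetherian X.left := LocallyOfFiniteType.isLocallyNoetherian X.hom
  have : CompactSpace X.left := 
    QuasiCompact.compactSpace_of_compactSpace X.hom
  constructor

variable (S) in
/-- The morphism `S × S ⟶ S × S`, `(x, y) ↦ (x, xy)`. -/
def shear : S.carrier ⊗ S.carrier ⟶ S.carrier ⊗ S.carrier :=
  lift (fst _ _) S.mul

lemma lift_comp_shear {T : Over (Spec (.of k))} (x y : T ⟶ S.carrier) :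
    lift x y ≫ S.shear = lift x (S.homMul x y) := by
  simp [shear, homMul]

/-- The map `a ↦ (a, y)` is continuous on underlying points. -/
lemma underlyingPoint_lift_left_mem_closure {x y : S.Point} {A : Set S.Point}
    (hx : underlyingPoint x ∈ closure (underlyingPoint '' A)) {B : Set (S.carrier ⊗ S.carrier).left}
    (hB : ∀ a ∈ A, underlyingPoint (lift a y) ∈ B) : underlyingPoint (lift x y) ∈ closure B := by
  let f : S.carrier ⟶ S.carrier ⊗ S.carrier := lift (𝟙 _) (toUnit _ ≫ y)
  have hf (a : S.Point) : underlyingPoint (lift a y) = f.left (underlyingPoint a) := by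
    rw [← underlyingPoint_comp, comp_lift, Category.comp_id, ← Category.assoc,
      toUnit_unique (a ≫ toUnit _) (𝟙 _), Category.id_comp]
  rw [hf]
  refine map_mem_closure f.left.continuous hx ?_
  rintro _ ⟨a, ha, rfl⟩
  rw [← hf]
  exact hB a ha

/-- The map `a ↦ (x, a)` is continuous on underlying points. -/
lemma underlyingPoint_lift_right_mem_closure {x y : S.Point} {A : Set S.Point}
    (hy : underlyingPoint y ∈ closure (underlyingPoint '' A)) {B : Set (S.carrier ⊗ S.carrier).left}
    (hB : ∀ a ∈ A, underlyingPoint (lift x a) ∈ B) : underlyingPoint (lift x y) ∈ closure B := by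
  let f : S.carrier ⟶ S.carrier ⊗ S.carrier := lift (toUnit _ ≫ x) (𝟙 _)
  have hf (a : S.Point) : underlyingPoint (lift x a) = f.left (underlyingPoint a) := by
    rw [← underlyingPoint_comp, comp_lift, Category.comp_id, ← Category.assoc,
      toUnit_unique (a ≫ toUnit _) (𝟙 _), Category.id_comp]
  rw [hf]
  refine map_mem_closure f.left.continuous hy ?_
  rintro _ ⟨a, ha, rfl⟩
  rw [← hf]
  exact hB a ha

variable [IsAlgClosed k]

/-- A point in the set-theoretic image of `(x, y) ↦ (x, xy)` is the image of a `k`-rational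
point. -/
lemma exists_eq_homMul_of_mem_range {x y : S.Point}
    (h : underlyingPoint (lift x y) ∈ Set.range S.shear.left) : ∃ z, y = S.homMul x z := by
  obtain ⟨t, ht⟩ := h
  have hc : IsClosed (S.shear.left ⁻¹' {underlyingPoint (lift x y)}) :=
    (isClosed_underlyingPoint _).preimage S.shear.left.continuous
  obtain ⟨p, hp⟩ := exists_underlyingPoint_mem hc ⟨t, ht⟩
  have hp' : underlyingPoint (p ≫ S.shear) = underlyingPoint (lift x y) := hp
  have hq := underlyingPoint_injective hp'
  obtain ⟨x', z, rfl⟩ : ∃ x' z, p = lift x' z := ⟨p ≫ fst _ _, p ≫ snd _ _, by simp⟩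
  rw [lift_comp_shear] at hq
  have h1 := hq =≫ fst _ _
  have h2 := hq =≫ snd _ _
  simp only [lift_fst, lift_snd] at h1 h2
  exact ⟨z, by rw [← h1, h2]⟩

/-- A nonempty commutative algebraic semigroup has an idempotent. For a point `a`, the pairs
`(aᵐ, aⁿ)` with `m < n` lie in the image of `(x, y) ↦ (x, xy)`, which is constructible. For large
exponents both these pairs and the pairs with `2n ≤ m` are dense in the closure of all pairs, so one
of the latter also lies in the image, and `aⁿ` is a multiple of its square. -/
lemma IsCommutative.exists_isIdempotent (hS : S.IsCommutative) (hne : Nonempty S.carrier.left) :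
    ∃ e : S.Point, S.homMul e e = e := by
  let := hS.homCommSemigroup (𝟙_ (Over (Spec (.of k))))
  obtain ⟨a, -⟩ := exists_underlyingPoint_mem (X := S.carrier) isClosed_univ Set.univ_nonempty
  obtain ⟨p, hp⟩ := exists_seq_mul_eq_add_succ a
  have := isNoetherian_left S.carrier
  have := isNoetherian_left (S.carrier ⊗ S.carrier)
  obtain ⟨N, hN⟩ := exists_forall_mem_closure_image_Ici fun n ↦ underlyingPoint (p n)
  have hN' (n m : ℕ) (hm : N ≤ m) :
      underlyingPoint (p m) ∈ closure (underlyingPoint '' (p '' Set.Ici n)) := by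
    rw [Set.image_image]
    exact hN n m hm
  have hI : Topology.IsConstructible (Set.range S.shear.left) := by
    have : LocallyOfFiniteType (S.shear.left ≫ (S.carrier ⊗ S.carrier).hom) := by
      rw [Over.w]; infer_instance
    have := locallyOfFiniteType_of_comp S.shear.left (S.carrier ⊗ S.carrier).hom
    rw [← Set.image_univ]
    exact Scheme.Hom.isConstructible_image _ .univ
  -- Pairs of powers of exponents at least `N + 1`: those with `m < n` and those with `2n ≤ m`.
  let A : Set (S.carrier ⊗ S.carrier).left :=
    {t | ∃ m n, N ≤ m ∧ m + 1 ≤ n ∧ underlyingPoint (lift (p m) (p n)) = t}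
  let B : Set (S.carrier ⊗ S.carrier).left :=
    {t | ∃ m n, N ≤ n ∧ N ≤ m ∧ 2 * n + 1 ≤ m ∧ underlyingPoint (lift (p m) (p n)) = t}
  obtain ⟨_, hI', m, n, -, -, hmn, rfl⟩ : (Set.range S.shear.left ∩ B).Nonempty := by
    refine hI.inter_nonempty (A := A) ⟨_, N, N + 1, le_rfl, le_rfl, rfl⟩ ?_ ?_ ?_
    · -- `A` is in the image: `p (m + 1 + r) = p m * p r`.
      rintro _ ⟨m, n, -, hmn, rfl⟩
      obtain ⟨r, rfl⟩ := Nat.exists_eq_add_of_le hmn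
      refine ⟨underlyingPoint (lift (p m) (p r)), ?_⟩
      rw [← underlyingPoint_comp, lift_comp_shear, Nat.add_right_comm, ← hp]
      rfl
    · -- `A` is in the closure of `B`: fix the second entry and let the first exponent grow.
      rintro _ ⟨m, n, hm, hmn, rfl⟩
      refine underlyingPoint_lift_left_mem_closure (hN' (max N (2 * n + 1)) m hm) ?_
      rintro _ ⟨m', hm', rfl⟩
      exact ⟨m', n, by omega, (le_max_left _ _).trans hm', (le_max_right _ _).trans hm', rfl⟩
    · -- `B` is in the closure of `A`: fix the first entry and let the second exponent grow.
      rintro _ ⟨m, n, hn, hm, hmn, rfl⟩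
      refine underlyingPoint_lift_right_mem_closure (hN' (m + 1) n hn) ?_
      rintro _ ⟨n', hn', rfl⟩
      exact ⟨m, n', hm, hn', rfl⟩
  obtain ⟨z, hz⟩ := exists_eq_homMul_of_mem_range hI'
  exact exists_idempotent_of_seq hp hmn hz

/-- The product of the idempotents, of which there are finitely many, is the smallest one. -/
lemma IsCommutative.exists_isSmallestIdempotent (hS : S.IsCommutative)
    (hne : Nonempty S.carrier.left) (hfin : Finite S.idempotents.left) :
    ∃ e : S.Point, e.IsSmallestIdempotent := by
  let := hS.homCommSemigroup (𝟙_ (Over (Spec (.of k))))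
  have hfin' : {e : S.Point | e * e = e}.Finite := by
    have : Finite (𝟙_ (Over (Spec (.of k))) ⟶ S.idempotents) :=
      Finite.of_injective _ underlyingPoint_injective
    refine (Set.finite_range fun p : 𝟙_ (Over (Spec (.of k))) ⟶ S.idempotents ↦
      p ≫ S.idempotentsι).subset fun e he ↦ ?_
    exact S.exists_comp_idempotentsι e he
  obtain ⟨e, he, h⟩ := exists_idempotent_mul_eq_of_finite hfin' (hS.exists_isIdempotent hne)
  exact ⟨e, he, fun f hf ↦ ⟨(h f hf).symm, ((hS.homMul_comm f e).trans (h f hf)).symm⟩⟩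

end AlgebraicSemigroup

/-! ### Idempotent points over the dual numbers -/

section DualNumbers

/-- If no nonzero element of `R` dies in both `R₁` and `R₂`, then a morphism from `Spec R` to a
separated scheme is determined by its restrictions to `Spec R₁` and `Spec R₂`. -/
lemma Spec_hom_ext_of_ker_inf_ker_eq_bot {R R₁ R₂ : CommRingCat.{u}} (φ₁ : R ⟶ R₁) (φ₂ : R ⟶ R₂)
    (hφ : RingHom.ker φ₁.hom ⊓ RingHom.ker φ₂.hom = ⊥) {Y Z : Scheme.{u}} (s : Y ⟶ Z)
    [IsSeparated s] {f g : Spec R ⟶ Y} (h : f ≫ s = g ≫ s)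
    (h₁ : Spec.map φ₁ ≫ f = Spec.map φ₁ ≫ g) (h₂ : Spec.map φ₂ ≫ f = Spec.map φ₂ ≫ g) :
    f = g := by
  let Y' : Over Z := Over.mk s
  let X' : Over Z := Over.mk (f ≫ s)
  let f' : X' ⟶ Y' := Over.homMk f
  let g' : X' ⟶ Y' := Over.homMk g h.symm
  have : IsSeparated Y'.hom := ‹_›
  have hc : IsClosedImmersion (equalizer.ι f' g').left := inferInstance
  -- The equalizer of `f` and `g` is a closed subscheme `Spec (R ⧸ I)`.
  obtain ⟨I, e, he⟩ := IsClosedImmersion.Spec_iff.1 hc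
  have key {R' : CommRingCat.{u}} (φ : R ⟶ R') (hφ : Spec.map φ ≫ f = Spec.map φ ≫ g) :
      I ≤ RingHom.ker φ.hom := by
    let T : Over Z := Over.mk (Spec.map φ ≫ f ≫ s)
    let t : T ⟶ X' := Over.homMk (Spec.map φ)
    have ht : t ≫ f' = t ≫ g' := Over.OverMorphism.ext hφ
    have h' : (equalizer.lift t ht).left ≫ (equalizer.ι f' g').left = Spec.map φ := by
      rw [← Over.comp_left, equalizer.lift_ι]; rfl
    rw [he, ← Category.assoc] at h'
    obtain ⟨ψ, hψ⟩ := Spec.map_surjective ((equalizer.lift t ht).left ≫ e.hom)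
    rw [← hψ, ← Spec.map_comp] at h'
    rw [← Spec.map_injective h']
    intro x hx
    have hx' : Ideal.Quotient.mk I x = 0 := Ideal.Quotient.eq_zero_iff_mem.2 hx
    change ψ.hom (Ideal.Quotient.mk I x) = 0
    rw [hx', map_zero]
  have hI : I = ⊥ := le_bot_iff.1 ((le_inf (key φ₁ h₁) (key φ₂ h₂)).trans hφ.le)
  have hiso : IsIso (CommRingCat.ofHom (Ideal.Quotient.mk I)) := by
    rw [ConcreteCategory.isIso_iff_bijective]
    refine ⟨?_, Ideal.Quotient.mk_surjective⟩
    change Function.Injective (Ideal.Quotient.mk I)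
    rw [RingHom.injective_iff_ker_eq_bot, Ideal.mk_ker, hI]
  have : IsIso (equalizer.ι f' g').left := by
    rw [he]; infer_instance
  rw [← cancel_epi (equalizer.ι f' g').left]
  exact congr(($(equalizer.condition f' g')).left)

variable (k : Type u) [Field k]

/-- The spectrum of the square-zero extension of `k` by a vector space `M`. For `M = k` this is the
spectrum of the dual numbers. -/
def specTrivSqZeroExt (M : Type u) [AddCommGroup M] [Module k M] [Module kᵐᵒᵖ M]
    [IsCentralScalar k M] : Over (Spec (.of k)) :=
  Over.mk (Spec.map (CommRingCat.ofHom (algebraMap k (TrivSqZeroExt k M))))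

variable {k}

/-- The morphism of `k`-schemes given by a linear map. -/
def specTrivSqZeroExtMap {M N : Type u} [AddCommGroup M] [Module k M] [Module kᵐᵒᵖ M]
    [IsCentralScalar k M] [AddCommGroup N] [Module k N] [Module kᵐᵒᵖ N]
    [IsCentralScalar k N] (f : M →ₗ[k] N) : specTrivSqZeroExt k N ⟶ specTrivSqZeroExt k M :=
  Over.homMk (Spec.map (CommRingCat.ofHom (TrivSqZeroExt.map f).toRingHom)) (by
    dsimp only [specTrivSqZeroExt, Over.mk_hom]
    rw [← Spec.map_comp, ← CommRingCat.ofHom_comp]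
    congr 2
    exact (TrivSqZeroExt.map f).comp_algebraMap)

lemma specTrivSqZeroExtMap_comp {M N P : Type u} [AddCommGroup M] [Module k M] [Module kᵐᵒᵖ M]
    [IsCentralScalar k M] [AddCommGroup N] [Module k N] [Module kᵐᵒᵖ N]
    [IsCentralScalar k N] [AddCommGroup P] [Module k P] [Module kᵐᵒᵖ P]
    [IsCentralScalar k P] (g : N →ₗ[k] P) (f : M →ₗ[k] N) :
    specTrivSqZeroExtMap (g ∘ₗ f) = specTrivSqZeroExtMap g ≫ specTrivSqZeroExtMap f := by
  have h : CommRingCat.ofHom (TrivSqZeroExt.map (g ∘ₗ f)).toRingHom =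
      CommRingCat.ofHom (TrivSqZeroExt.map f).toRingHom ≫
        CommRingCat.ofHom (TrivSqZeroExt.map g).toRingHom := by
    rw [TrivSqZeroExt.map_comp_map]
    rfl
  exact Over.OverMorphism.ext ((congrArg Spec.map h).trans (Spec.map_comp _ _))

lemma specTrivSqZeroExtMap_id {M : Type u} [AddCommGroup M] [Module k M] [Module kᵐᵒᵖ M]
    [IsCentralScalar k M] :
    specTrivSqZeroExtMap (LinearMap.id : M →ₗ[k] M) = 𝟙 _ := by
  have h : CommRingCat.ofHom (TrivSqZeroExt.map (LinearMap.id : M →ₗ[k] M)).toRingHom = 𝟙 _ := by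
    rw [TrivSqZeroExt.map_id]
    rfl
  exact Over.OverMorphism.ext ((congrArg Spec.map h).trans (Spec.map_id _))

/-- Points over `k[ε₁, ε₂] / (ε₁, ε₂)²` of a separated scheme are determined by their restrictions
to `ε₂ = 0` and to `ε₁ = 0`. -/
lemma specTrivSqZeroExt_prod_hom_ext {Y : Over (Spec (.of k))} [IsSeparated Y.hom]
    {f g : specTrivSqZeroExt k (k × k) ⟶ Y}
    (h₁ : specTrivSqZeroExtMap (LinearMap.fst k k k) ≫ f =
      specTrivSqZeroExtMap (LinearMap.fst k k k) ≫ g)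
    (h₂ : specTrivSqZeroExtMap (LinearMap.snd k k k) ≫ f =
      specTrivSqZeroExtMap (LinearMap.snd k k k) ≫ g) : f = g := by
  refine Over.OverMorphism.ext (Spec_hom_ext_of_ker_inf_ker_eq_bot _ _ ?_ Y.hom
    ((Over.w f).trans (Over.w g).symm) congr(($h₁).left) congr(($h₂).left))
  rw [eq_bot_iff]
  rintro x ⟨hx₁, hx₂⟩
  have h1 : TrivSqZeroExt.map (LinearMap.fst k k k) x = 0 := hx₁
  have h2 : TrivSqZeroExt.map (LinearMap.snd k k k) x = 0 := hx₂
  have e1 := congr(($h1).fst)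
  have e2 := congr(($h1).snd)
  have e3 := congr(($h2).snd)
  rw [TrivSqZeroExt.fst_map] at e1
  rw [TrivSqZeroExt.snd_map] at e2 e3
  exact TrivSqZeroExt.ext e1 (Prod.ext e2 e3)

end DualNumbers

namespace AlgebraicSemigroup

variable {k : Type u} [Field k] {S : AlgebraicSemigroup k}

/-- The tangent space to the scheme of idempotents is zero: an idempotent point `u` over the dual
numbers is constant. Let `e` be its value at `ε = 0` and `w = e * u`, and write `u(ε)`, `w(ε)` to
display the dependence on `ε`. The point `u(ε₁) * u(ε₂)` restricts to `w` for `ε₂ = 0` and for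
`ε₁ = 0`, so it is `w(ε₁ + ε₂)`, and `ε₁ = ε₂ = ε` gives `u(ε) = w(2ε)`. Multiplying by `e` gives
`w(ε) = w(2ε)`, whence `u = w` is constant. -/
lemma IsCommutative.specTrivSqZeroExtMap_zero_comp_eq (hS : S.IsCommutative)
    (u : specTrivSqZeroExt k k ⟶ S.carrier) (hu : S.homMul u u = u) :
    specTrivSqZeroExtMap (0 : k →ₗ[k] k) ≫ u = u := by
  let := hS.homCommSemigroup (specTrivSqZeroExt k k)
  let := hS.homCommSemigroup (specTrivSqZeroExt k (k × k))
  have huu : u * u = u := hu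
  -- The operation of a linear change of parameters `g` on a point `x`.
  let act {M N : Type u} [AddCommGroup M] [Module k M] [Module kᵐᵒᵖ M] [IsCentralScalar k M]
    [AddCommGroup N] [Module k N] [Module kᵐᵒᵖ N] [IsCentralScalar k N] (g : M →ₗ[k] N)
    (x : specTrivSqZeroExt k M ⟶ S.carrier) : specTrivSqZeroExt k N ⟶ S.carrier :=
      specTrivSqZeroExtMap g ≫ x
  have act_act {M N P : Type u} [AddCommGroup M] [Module k M] [Module kᵐᵒᵖ M]
      [IsCentralScalar k M] [AddCommGroup N] [Module k N] [Module kᵐᵒᵖ N]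
      [IsCentralScalar k N] [AddCommGroup P] [Module k P] [Module kᵐᵒᵖ P]
      [IsCentralScalar k P] (g : N →ₗ[k] P) (f : M →ₗ[k] N)
      (x : specTrivSqZeroExt k M ⟶ S.carrier) : act g (act f x) = act (g ∘ₗ f) x := by
    simp only [act, specTrivSqZeroExtMap_comp, Category.assoc]
  have act_id (x : specTrivSqZeroExt k k ⟶ S.carrier) : act LinearMap.id x = x := by
    simp only [act, specTrivSqZeroExtMap_id, Category.id_comp]
  have act_mul (g : k →ₗ[k] k) (x y : specTrivSqZeroExt k k ⟶ S.carrier) :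
      act g (x * y) = act g x * act g y := S.comp_homMul _ x y
  have act_mul_proj (g : k × k →ₗ[k] k) (x y : specTrivSqZeroExt k (k × k) ⟶ S.carrier) :
      act g (x * y) = act g x * act g y := S.comp_homMul _ x y
  have ext {x y : specTrivSqZeroExt k (k × k) ⟶ S.carrier}
      (h₁ : act (LinearMap.fst k k k) x = act (LinearMap.fst k k k) y)
      (h₂ : act (LinearMap.snd k k k) x = act (LinearMap.snd k k k) y) : x = y :=
    specTrivSqZeroExt_prod_hom_ext h₁ h₂
  change act (0 : k →ₗ[k] k) u = u
  let e := act (0 : k →ₗ[k] k) u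
  have act_e (g : k →ₗ[k] k) : act g e = e := by
    simp only [e, act_act, LinearMap.comp_zero]
  have hee : e * e = e := by rw [← act_mul, huu]
  -- `u(ε) = w(2ε)`
  have h2 : act (LinearMap.id + LinearMap.id) (e * u) = u := by
    have h : act (LinearMap.inl k k k) u * act (LinearMap.inr k k k) u =
        act (LinearMap.id.prod LinearMap.id) (e * u) := by
      apply ext
      · rw [act_mul_proj, act_act, act_act, act_act, LinearMap.fst_comp_inl, LinearMap.fst_comp_inr,
          LinearMap.fst_prod, act_id, act_id, mul_comm]
      · rw [act_mul_proj, act_act, act_act, act_act, LinearMap.snd_comp_inl, LinearMap.snd_comp_inr,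
          LinearMap.snd_prod, act_id, act_id]
    have h' := congr(act (LinearMap.coprod LinearMap.id LinearMap.id) $h)
    rw [act_mul_proj, act_act, act_act, act_act, LinearMap.coprod_inl, LinearMap.coprod_inr,
      LinearMap.coprod_comp_prod, act_id, huu] at h'
    exact h'.symm
  -- `u = w`, from multiplying the previous equality by `e`
  have heu : e * u = u := by
    have h : act (LinearMap.id + LinearMap.id) (e * (e * u)) = e * u := by rw [act_mul, act_e, h2]
    rwa [← _root_.mul_assoc, hee, h2, eq_comm] at h
  rw [heu] at h2
  -- From `u(2ε) = u(ε)` follows `u(2ε₁ - ε₂) = u(ε₁ - ε₂)`, as both sides have the same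
  -- restrictions; then `ε₁ = ε₂ = ε` gives `u(ε) = u(0)`.
  have h : act ((LinearMap.id + LinearMap.id).prod (-LinearMap.id)) u =
      act (LinearMap.id.prod (-LinearMap.id)) u := by
    apply ext
    · rw [act_act, act_act, LinearMap.fst_prod, LinearMap.fst_prod, h2, act_id]
    · rw [act_act, act_act, LinearMap.snd_prod, LinearMap.snd_prod]
  have h' := congr(act (LinearMap.coprod LinearMap.id LinearMap.id) $h)
  rw [act_act, act_act, LinearMap.coprod_comp_prod, LinearMap.coprod_comp_prod,
    LinearMap.id_comp, LinearMap.id_comp, LinearMap.id_comp, add_neg_cancel_right,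
    add_neg_cancel, act_id] at h'
  exact h'.symm

end AlgebraicSemigroup

/-! ### Unramified schemes over a field -/

/-- The algebra homomorphism `a ↦ χ a + ε • d a` to the dual numbers given by a `k`-valued character
`χ` and a derivation `d`. -/
def dualNumberHom {k A : Type*} [Field k] [CommRing A] [Algebra k A] (χ : A →ₐ[k] k)
    (d : A →ₗ[k] k) (hd : ∀ a b, d (a * b) = χ a * d b + χ b * d a) :
    A →ₐ[k] TrivSqZeroExt k k :=
  have hd1 : d 1 = 0 := by simpa using hd 1 1
  AlgHom.ofLinearMap
    { toFun a := (TrivSqZeroExt.inl (χ a) + TrivSqZeroExt.inr (d a) : TrivSqZeroExt k k)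
      map_add' a b := by ext <;> simp
      map_smul' c a := by ext <;> simp }
    (by ext <;> simp [hd1])
    (fun a b ↦ by ext <;> simp [hd, mul_comm])

/-- An algebra of finite type over an algebraically closed field all of whose points over the dual
numbers are constant is unramified. Otherwise, the module of differentials would have a simple
quotient, which is one-dimensional by the Nullstellensatz and gives a nonconstant point. -/
lemma Algebra.FormallyUnramified.of_forall_dualNumber {k A : Type u} [Field k] [IsAlgClosed k]
    [CommRing A] [Algebra k A] [Algebra.FiniteType k A]
    (h : ∀ φ : A →ₐ[k] TrivSqZeroExt k k, ∀ a, (φ a).snd = 0) :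
    Algebra.FormallyUnramified k A := by
  rw [Algebra.formallyUnramified_iff]
  by_contra hΩ
  rw [not_subsingleton_iff_nontrivial] at hΩ
  obtain ⟨N, hN, -⟩ :=
    (eq_top_or_exists_le_coatom (⊥ : Submodule A (Ω[A⁄k]))).resolve_left bot_ne_top
  have hsimple : IsSimpleModule A (Ω[A⁄k] ⧸ N) := isSimpleModule_iff_isCoatom.2 hN
  obtain ⟨m, hm, ⟨e⟩⟩ := isSimpleModule_iff_quot_maximal.1 hsimple
  let := Ideal.Quotient.field m
  have : Module.Finite k (A ⧸ m) := finite_of_finite_type_of_isJacobsonRing _ _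
  -- A simple quotient of the module of differentials is `A ⧸ m = k` for a maximal ideal `m`.
  let ψ : k ≃ₐ[k] A ⧸ m := AlgEquiv.ofBijective (Algebra.ofId k (A ⧸ m))
    (IsAlgClosed.algebraMap_bijective_of_isIntegral (k := k) (K := A ⧸ m))
  let χ : A →ₐ[k] k := ψ.symm.toAlgHom.comp (Ideal.Quotient.mkₐ k m)
  let l : Ω[A⁄k] →ₗ[A] A ⧸ m := e.toLinearMap ∘ₗ N.mkQ
  let d : A →ₗ[k] k := ψ.symm.toLinearMap ∘ₗ (l.restrictScalars k) ∘ₗ (KaehlerDifferential.D k A)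
  have hd (a b : A) : d (a * b) = χ a * d b + χ b * d a := by
    have hsmul (x : A) (y : A ⧸ m) : ψ.symm (x • y) = χ x * ψ.symm y := by
      rw [Algebra.smul_def, map_mul]
      rfl
    change ψ.symm (l (KaehlerDifferential.D k A (a * b))) = _
    rw [Derivation.leibniz, map_add, map_smul, map_smul, map_add, hsmul, hsmul]
    rfl
  have hl : l = 0 := by
    have hda (a : A) : l (KaehlerDifferential.D k A a) = 0 := by
      have hd0 : (0 : k) + d a = 0 := h (dualNumberHom χ d hd) a
      rw [zero_add] at hd0
      exact ψ.symm.map_eq_zero_iff.1 hd0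
    have htop : ⊤ ≤ LinearMap.ker l := by
      rw [← KaehlerDifferential.span_range_derivation, Submodule.span_le]
      rintro _ ⟨a, rfl⟩
      exact hda a
    exact LinearMap.ext fun x ↦ htop (Submodule.mem_top (x := x))
  have hsurj : Function.Surjective l := e.surjective.comp N.mkQ_surjective
  obtain ⟨x, hx⟩ := hsurj 1
  rw [hl] at hx
  exact zero_ne_one hx

/-- A property of ring homomorphisms that defines a property of morphisms of schemes can be checked
on the charts of the standard affine cover. -/
lemma AlgebraicGeometry.HasRingHomProperty.iff_forall_affineOpenCover
    {P : MorphismProperty Scheme.{u}}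
    {Q : ∀ {R S : Type u} [CommRing R] [CommRing S], (R →+* S) → Prop} [HasRingHomProperty P Q]
    {X : Scheme.{u}} {R : CommRingCat.{u}} (f : X ⟶ Spec R) :
    P f ↔ ∀ i, Q (Spec.preimage (X.affineOpenCover.f i ≫ f)).hom := by
  rw [HasRingHomProperty.iff_of_source_openCover (P := P) X.affineCover]
  refine forall_congr' fun i ↦ ?_
  rw [← HasRingHomProperty.iff_of_isAffine (P := P), ← HasRingHomProperty.Spec_iff (P := P),
    Spec.map_preimage]
  rfl

/-- A morphism locally of finite type to the spectrum of an algebraically closed field is formally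
unramified if all points over the dual numbers of the source are constant. -/
lemma formallyUnramified_of_forall_dualNumber {k : Type u} [Field k] [IsAlgClosed k]
    {X : Over (Spec (.of k))} [LocallyOfFiniteType X.hom]
    (h : ∀ u : specTrivSqZeroExt k k ⟶ X, specTrivSqZeroExtMap (0 : k →ₗ[k] k) ≫ u = u) :
    FormallyUnramified X.hom := by
  have hft := (HasRingHomProperty.iff_forall_affineOpenCover (P := @LocallyOfFiniteType) X.hom).1
    inferInstance
  rw [HasRingHomProperty.iff_forall_affineOpenCover (P := @FormallyUnramified)]
  intro i
  have hfti := hft i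
  generalize hθ : Spec.preimage (X.left.affineOpenCover.f i ≫ X.hom) = θ at *
  have hθ' : Spec.map θ = X.left.affineOpenCover.f i ≫ X.hom := by rw [← hθ, Spec.map_preimage]
  algebraize [θ.hom]
  refine Algebra.FormallyUnramified.of_forall_dualNumber (k := k) fun φ a ↦ ?_
  have hw : (Spec.map (CommRingCat.ofHom φ.toRingHom) ≫ X.left.affineOpenCover.f i) ≫ X.hom =
      Spec.map (CommRingCat.ofHom (algebraMap k (TrivSqZeroExt k k))) := by
    rw [Category.assoc, ← hθ', ← Spec.map_comp]
    exact congrArg (fun f ↦ Spec.map (CommRingCat.ofHom f)) φ.comp_algebraMap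
  let u : specTrivSqZeroExt k k ⟶ X :=
    Over.homMk (Spec.map (CommRingCat.ofHom φ.toRingHom) ≫ X.left.affineOpenCover.f i) hw
  have hu : Spec.map (CommRingCat.ofHom (TrivSqZeroExt.map (0 : k →ₗ[k] k)).toRingHom) ≫
      Spec.map (CommRingCat.ofHom φ.toRingHom) ≫ X.left.affineOpenCover.f i =
      Spec.map (CommRingCat.ofHom φ.toRingHom) ≫ X.left.affineOpenCover.f i := congr(($(h u)).left)
  rw [← Category.assoc, cancel_mono, ← Spec.map_comp] at hu
  have ha := congr(($(Spec.map_injective hu)).hom a)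
  have ha' : TrivSqZeroExt.map (0 : k →ₗ[k] k) (φ a) = φ a := ha
  rw [← ha', TrivSqZeroExt.snd_map, LinearMap.zero_apply]

/-- A scheme that is unramified over a field is reduced. -/
lemma isReduced_of_formallyUnramified {k : Type u} [Field k] {X : Scheme.{u}}
    (f : X ⟶ Spec (.of k)) [LocallyOfFiniteType f] [FormallyUnramified f] : IsReduced X := by
  have hft := (HasRingHomProperty.iff_forall_affineOpenCover (P := @LocallyOfFiniteType) f).1
    inferInstance
  have hu := (HasRingHomProperty.iff_forall_affineOpenCover (P := @FormallyUnramified) f).1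
    inferInstance
  rw [IsReduced.iff_of_openCover _ X.affineOpenCover.openCover]
  intro i
  have hfti := hft i
  have hui := hu i
  generalize Spec.preimage (X.affineOpenCover.f i ≫ f) = θ at *
  algebraize [θ.hom]
  have : _root_.IsReduced (X.affineOpenCover.X i) :=
    Algebra.FormallyUnramified.isReduced_of_field k _
  change IsReduced (Spec (X.affineOpenCover.X i))
  infer_instance

/-- A quasi-compact scheme that is unramified over a field is finite over it. -/
lemma isFinite_of_formallyUnramified {k : Type u} [Field k] {X : Scheme.{u}}
    (f : X ⟶ Spec (.of k)) [LocallyOfFiniteType f] [FormallyUnramified f] [QuasiCompact f] :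
    IsFinite f := by
  have hft := (HasRingHomProperty.iff_forall_affineOpenCover (P := @LocallyOfFiniteType) f).1
    inferInstance
  have hu := (HasRingHomProperty.iff_forall_affineOpenCover (P := @FormallyUnramified) f).1
    inferInstance
  have : LocallyQuasiFinite f := by
    rw [HasRingHomProperty.iff_forall_affineOpenCover (P := @LocallyQuasiFinite)]
    intro i
    have hfti := hft i
    have hui := hu i
    generalize Spec.preimage (X.affineOpenCover.f i ≫ f) = θ at *
    algebraize [θ.hom]
    exact inferInstanceAs (Algebra.QuasiFinite k (X.affineOpenCover.X i))
  have : IsLocallyArtinian (Spec (.of k)) :=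
    Scheme.isLocallyArtinianScheme_Spec.2 (inferInstanceAs (IsArtinianRing k))
  exact IsFinite.of_locallyQuasiFinite f

/-- The local rings of a reduced scheme that is locally Artinian are fields. -/
lemma subsingleton_zariskiTangentSpace {X : Scheme.{u}} [IsReduced X] [IsLocallyArtinian X]
    (x : X) : Subsingleton (ZariskiTangentSpace X x) := by
  obtain ⟨_, ⟨U, hU, rfl⟩, hxU, -⟩ :=
    X.isBasis_affineOpens.exists_subset_of_mem_open (Set.mem_univ x) isOpen_univ
  have : IsArtinianRing Γ(X, U) := IsLocallyArtinian.isArtinianRing_presheaf_obj ⟨U, hU⟩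
  let := X.presheaf.algebra_section_stalk (⟨x, hxU⟩ : U)
  have : IsLocalization.AtPrime (X.presheaf.stalk x) (hU.primeIdealOf ⟨x, hxU⟩).asIdeal :=
    hU.isLocalization_stalk ⟨x, hxU⟩
  have : IsArtinianRing (X.presheaf.stalk x) := IsArtinianRing.localization_artinian
    (hU.primeIdealOf ⟨x, hxU⟩).asIdeal.primeCompl (X.presheaf.stalk x)
  have : Subsingleton (IsLocalRing.CotangentSpace (X.presheaf.stalk x)) :=
    IsLocalRing.subsingleton_cotangentSpace_iff.2
      (IsArtinianRing.isField_of_isReduced_of_isLocalRing _)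
  infer_instance

end

theorem mainTheorem3 {k : Type u} [Field k] [IsAlgClosed k] (S : AlgebraicSemigroup k)
    (hS : S.IsCommutative) :
    ((∀ x : S.idempotents.left, Subsingleton (ZariskiTangentSpace S.idempotents.left x)) ∧
      IsFinite S.idempotents.hom ∧ IsReduced S.idempotents.left) ∧
    (Nonempty S.carrier.left → ∃ e₀ : S.Point, e₀.IsSmallestIdempotent) ∧
    (∀ e₀ : S.Point, e₀.IsSmallestIdempotent →
      ∀ (F : Type u) [Field F] [Algebra F k] (S₀ : S.FStructure F), e₀.IsDefinedOver S₀) := by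
  have hunr : FormallyUnramified S.idempotents.hom := by
    refine formallyUnramified_of_forall_dualNumber fun u ↦ ?_
    rw [← cancel_mono S.idempotentsι, Category.assoc]
    refine hS.specTrivSqZeroExtMap_zero_comp_eq _ ?_
    rw [← S.comp_homMul, S.idempotentsι_homMul_self]
  have hfin : IsFinite S.idempotents.hom := isFinite_of_formallyUnramified _
  have hred : IsReduced S.idempotents.left := isReduced_of_formallyUnramified S.idempotents.hom
  have hart : IsLocallyArtinian S.idempotents.left := by
    have : IsLocallyArtinian (Spec (.of k)) :=
      Scheme.isLocallyArtinianScheme_Spec.2 (inferInstanceAs (IsArtinianRing k))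
    exact .of_locallyQuasiFinite S.idempotents.hom
  refine ⟨⟨subsingleton_zariskiTangentSpace, hfin, hred⟩, fun hne ↦ ?_, fun e he F _ _ S₀ ↦ ?_⟩
  · refine hS.exists_isSmallestIdempotent hne ?_
    have : CompactSpace S.idempotents.left :=
      QuasiCompact.compactSpace_of_compactSpace S.idempotents.hom
    exact finite_of_compact_of_discrete
  · exact he.isDefinedOver hS S₀
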